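/- Let $m\ge 0$ and $l\ge 0$ be integers, let $V$ be a real vector space of dimension $m+1$ with its standard (Euclidean) topology, and let $\nu_0,\ldots,\nu_l$ be Borel probability measures on $V$. If $l\le m$, then there exists an affine hyperplane $\{v\in V : f(v)=y\}$, given by a non-zero linear form $f:V\to\mathbb{R}$ and a real number $y$, such that $$\nu_j\{v\in V : y\ge f(v)\}\ \ge\ \tfrac12\quad\text{and}\quad \nu_j\{v\in V : y\le f(v)\}\ \ge\ \tfrac12\qquad\text{for } j=0,\ldots,l.$$ -/

import Mathlib

/-! Affine functions `w x` on `V` have `m + 2` coefficients `x`. Integrating the truncation of `k *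
w x` against `m + 1` measures gives a continuous odd map of `x`, which by Borsuk–Ulam
(`exists_sum_abs_eq_one_and_eq_zero_of_odd`) vanishes somewhere on the `ℓ¹` sphere. Truncation makes
the integrals finite without moment assumptions. As `k → ∞`, a limit point of these zeros bisects
every measure (`half_le_measure_of_integral_truncate_nonneg`), and it is not a constant function,
since a non-zero constant cannot bisect.

Borsuk–Ulam is proved in the manner of Tucker and Ky Fan. A map without zeros labels each point of
the sphere by a coordinate where it is large, together with the sign there. The crosspolytope
hemispheres, finely subdivided, then push forward to chains of labels in which the number of
sign-alternating simplices is odd in every dimension (`no_hemispheres`). In dimension `n` this would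
need `n + 1` distinct indices among `n`. -/

/-- Augmented chains modulo two: a simplex is the multiset of its vertices. -/
abbrev ModTwoChain (E : Type*) := Multiset E →₀ ZMod 2

namespace ModTwoChain

open Finsupp

/-! ### Chain algebra modulo two: cones, induced maps, boundary. -/

section Boundary

variable {E : Type*}

/-- The linear extension of a map defined on simplices. -/
noncomputable def extend {M : Type*} [AddCommMonoid M] [Module (ZMod 2) M]
    (g : Multiset E → M) : ModTwoChain E →ₗ[ZMod 2] M :=
  Finsupp.lift M (ZMod 2) (Multiset E) g

@[simp] lemma extend_single {M : Type*} [AddCommMonoid M] [Module (ZMod 2) M]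
    (g : Multiset E → M) (s : Multiset E) : extend g (single s 1) = g s := by
  simp [extend]

lemma hom_ext {M : Type*} [AddCommMonoid M] [Module (ZMod 2) M]
    {f g : ModTwoChain E →ₗ[ZMod 2] M} (h : ∀ s, f (single s 1) = g (single s 1)) : f = g :=
  Finsupp.lhom_ext' fun s => LinearMap.ext_ring (h s)

/-- The chains all of whose simplices satisfy `P`. -/
def carried (P : Multiset E → Prop) : Submodule (ZMod 2) (ModTwoChain E) :=
  Finsupp.supported (ZMod 2) (ZMod 2) {s | P s}

lemma single_mem_carried {P : Multiset E → Prop} {s : Multiset E} (h : P s) :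
    (single s 1 : ModTwoChain E) ∈ carried P :=
  Finsupp.single_mem_supported _ _ h

lemma carried_eq_span (P : Multiset E → Prop) :
    carried P = Submodule.span (ZMod 2) ((fun s => single s 1) '' {s | P s}) :=
  Finsupp.supported_eq_span_single _ _

lemma map_mem_of_carried {M : Type*} [AddCommMonoid M] [Module (ZMod 2) M]
    {P : Multiset E → Prop} (f : ModTwoChain E →ₗ[ZMod 2] M) (N : Submodule (ZMod 2) M)
    (h : ∀ s, P s → f (single s 1) ∈ N) {c : ModTwoChain E} (hc : c ∈ carried P) : f c ∈ N := by
  rw [carried_eq_span] at hc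
  have : Submodule.span (ZMod 2) ((fun s => (single s 1 : ModTwoChain E)) '' {s | P s}) ≤
      N.comap f := by
    rw [Submodule.span_le]
    rintro _ ⟨s, hs, rfl⟩
    exact h s hs
  exact this hc

lemma eqOn_of_carried {M : Type*} [AddCommGroup M] [Module (ZMod 2) M]
    {P : Multiset E → Prop} (f g : ModTwoChain E →ₗ[ZMod 2] M)
    (h : ∀ s, P s → f (single s 1) = g (single s 1)) {c : ModTwoChain E} (hc : c ∈ carried P) :
    f c = g c := by
  have := map_mem_of_carried (f - g) ⊥ (fun s hs => by simp [h s hs]) hc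
  simpa [sub_eq_zero] using this

lemma carried_mono {P Q : Multiset E → Prop} (h : ∀ s, P s → Q s) : carried P ≤ carried Q :=
  Finsupp.supported_mono h

/-- The cone with apex `b`. -/
noncomputable def cone (b : E) : ModTwoChain E →ₗ[ZMod 2] ModTwoChain E :=
  extend fun s => single (b ::ₘ s) 1

@[simp] lemma cone_single (b : E) (s : Multiset E) :
    cone b (single s 1) = single (b ::ₘ s) 1 := extend_single _ _

/-- The chain map induced by a map of vertices. -/
noncomputable def map {E' : Type*} (g : E → E') : ModTwoChain E →ₗ[ZMod 2] ModTwoChain E' :=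
  extend fun s => single (s.map g) 1

@[simp] lemma map_single {E' : Type*} (g : E → E') (s : Multiset E) :
    map g (single s 1) = single (s.map g) 1 := extend_single _ _

open Classical in
/-- The boundary operator. -/
noncomputable def boundary : ModTwoChain E →ₗ[ZMod 2] ModTwoChain E :=
  extend fun s => (s.map fun v => single (s.erase v) 1).sum

open Classical in
lemma boundary_single (s : Multiset E) :
    boundary (single s 1) = (s.map fun v => (single (s.erase v) 1 : ModTwoChain E)).sum :=
  extend_single _ _

@[simp] lemma boundary_single_zero :
    boundary (single (0 : Multiset E) 1) = 0 := by simp [boundary_single]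

/-- Erasing `v ∈ s` commutes with adjoining `b` even when `v = b`, so degenerate simplices need no
separate treatment. -/
lemma boundary_single_cons (b : E) (s : Multiset E) :
    boundary (single (b ::ₘ s) 1) = single s 1 + cone b (boundary (single s 1)) := by
  classical
  rw [boundary_single, boundary_single, Multiset.map_cons, Multiset.sum_cons,
    Multiset.erase_cons_head, map_multiset_sum, Multiset.map_map]
  congr 2
  refine Multiset.map_congr rfl fun v hv => ?_
  simp [Multiset.erase_cons_tail_of_mem hv]

lemma boundary_cone (b : E) (c : ModTwoChain E) :
    boundary (cone b c) = c + cone b (boundary c) := by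
  have : boundary ∘ₗ cone b = LinearMap.id + cone b ∘ₗ boundary :=
    hom_ext fun s => by simp [boundary_single_cons]
  exact LinearMap.congr_fun this c

lemma boundary_boundary (c : ModTwoChain E) : boundary (boundary c) = 0 := by
  have : (boundary : ModTwoChain E →ₗ[ZMod 2] _) ∘ₗ boundary = 0 := by
    refine hom_ext fun s => ?_
    induction s using Multiset.induction with
    | empty => simp
    | cons b s ih =>
      simp only [LinearMap.comp_apply, LinearMap.zero_apply] at ih ⊢
      rw [boundary_single_cons, map_add, boundary_cone, ih, map_zero, add_zero,
        ZModModule.add_self]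
  exact LinearMap.congr_fun this c

lemma map_cone {E' : Type*} (g : E → E') (b : E) (c : ModTwoChain E) :
    map g (cone b c) = cone (g b) (map g c) := by
  have : map g ∘ₗ cone b = cone (g b) ∘ₗ map g := hom_ext fun s => by simp
  exact LinearMap.congr_fun this c

lemma boundary_map {E' : Type*} (g : E → E') (c : ModTwoChain E) :
    boundary (map g c) = map g (boundary c) := by
  have : boundary ∘ₗ map g = map g ∘ₗ boundary := by
    refine hom_ext fun s => ?_
    induction s using Multiset.induction with
    | empty => simp
    | cons b s ih =>
      simp only [LinearMap.comp_apply, map_single, Multiset.map_cons] at ih ⊢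
      rw [boundary_single_cons, ih, boundary_single_cons, map_add, map_cone, map_single]
  exact LinearMap.congr_fun this c

lemma cone_mem_carried {P Q : Multiset E → Prop} {b : E} (h : ∀ s, P s → Q (b ::ₘ s))
    {c : ModTwoChain E} (hc : c ∈ carried P) : cone b c ∈ carried Q :=
  map_mem_of_carried _ _ (fun s hs => by simpa using single_mem_carried (h s hs)) hc

lemma map_mem_carried {E' : Type*} {P : Multiset E → Prop} {Q : Multiset E' → Prop} {g : E → E'}
    (h : ∀ s, P s → Q (s.map g))
    {c : ModTwoChain E} (hc : c ∈ carried P) : map g c ∈ carried Q :=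
  map_mem_of_carried _ _ (fun s hs => by simpa using single_mem_carried (h s hs)) hc

/-- Induction on simplices along the faces of codimension one. -/
lemma face_induction {P : Multiset E → Prop} (zero : P 0)
    (step : ∀ s, s ≠ 0 → (∀ t, t < s → P t) → P s) (s : Multiset E) : P s := by
  induction s using Multiset.strongInductionOn with
  | ih s ih =>
    by_cases h : s = 0
    · exact h ▸ zero
    · exact step s h ih

lemma boundary_single_mem_carried (s : Multiset E) :
    boundary (single s 1) ∈ carried (fun t => t < s) := by
  classical
  rw [boundary_single]
  refine multiset_sum_mem _ fun c hc => ?_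
  obtain ⟨v, hv, rfl⟩ := Multiset.mem_map.1 hc
  exact single_mem_carried (Multiset.erase_lt.2 hv)

end Boundary

/-! ### Barycenters and the contraction estimate. -/

section Barycenter

variable {E : Type*}

/-- The barycenter of a simplex. -/
noncomputable def barycenter [AddCommGroup E] [Module ℝ E] (s : Multiset E) : E :=
  (s.card : ℝ)⁻¹ • s.sum

lemma barycenter_map_neg [AddCommGroup E] [Module ℝ E] (s : Multiset E) :
    barycenter (s.map Neg.neg) = -barycenter s := by
  simp [barycenter, Multiset.sum_map_neg']

lemma barycenter_mem [AddCommGroup E] [Module ℝ E] {K : Set E} (hK : Convex ℝ K)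
    {s : Multiset E} (h0 : s ≠ 0) (hs : ∀ v ∈ s, v ∈ K) : barycenter s ∈ K := by
  classical
  have hc : (0 : ℝ) < s.card := by
    exact_mod_cast Multiset.card_pos.2 h0
  rw [barycenter, Finset.sum_multiset_count, Finset.smul_sum]
  simp_rw [← Nat.cast_smul_eq_nsmul ℝ, smul_smul]
  refine hK.sum_mem (fun _ _ => by positivity) ?_ fun v hv => hs v (by simpa using hv)
  rw [← Finset.mul_sum, ← Nat.cast_sum, Multiset.toFinset_sum_count_eq, inv_mul_cancel₀ hc.ne']

/-- The barycenter minus `v` is the average of the differences `u - v`, one of which is zero. Only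
an upper bound `n` on the number of vertices is used, so that one rate serves all faces. -/
lemma dist_barycenter_le [NormedAddCommGroup E] [NormedSpace ℝ E] {s : Multiset E} {D : ℝ}
    {n : ℕ} (hn : s.card ≤ n) (hD : ∀ u ∈ s, ∀ v ∈ s, dist u v ≤ D) {v : E} (hv : v ∈ s) :
    dist v (barycenter s) ≤ (1 - (n : ℝ)⁻¹) * D := by
  obtain ⟨t, rfl⟩ := Multiset.exists_cons_of_mem hv
  have hD0 : 0 ≤ D := by simpa using hD v hv v hv
  set k := t.card with hk
  have hkpos : (0 : ℝ) < k + 1 := by positivity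
  have hsum : ‖(t.map fun u => u - v).sum‖ ≤ k * D := by
    refine (norm_multiset_sum_le _).trans ?_
    rw [Multiset.map_map]
    refine (Multiset.sum_le_card_nsmul _ D ?_).trans (by simp [hk])
    intro x hx
    obtain ⟨u, hu, rfl⟩ := Multiset.mem_map.1 hx
    simpa [dist_eq_norm] using hD u (Multiset.mem_cons_of_mem hu) v hv
  have hb : barycenter (v ::ₘ t) - v = ((k : ℝ) + 1)⁻¹ • (t.map fun u => u - v).sum := by
    rw [barycenter, Multiset.sum_map_sub, Multiset.map_id', Multiset.map_const',
      Multiset.sum_replicate, Multiset.card_cons, Multiset.sum_cons, ← hk,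
      ← Nat.cast_smul_eq_nsmul ℝ, eq_inv_smul_iff₀ hkpos.ne', smul_sub, Nat.cast_add, Nat.cast_one,
      smul_inv_smul₀ hkpos.ne', add_smul, one_smul]
    abel
  rw [dist_comm, dist_eq_norm, hb, norm_smul, norm_inv, Real.norm_of_nonneg hkpos.le]
  have hkn : ((k : ℝ) + 1) ≤ n := by
    rw [Multiset.card_cons] at hn
    exact_mod_cast hn
  calc ((k : ℝ) + 1)⁻¹ * ‖(t.map fun u => u - v).sum‖ ≤ ((k : ℝ) + 1)⁻¹ * (k * D) := by gcongr
    _ = (1 - ((k : ℝ) + 1)⁻¹) * D := by field_simp; ring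
    _ ≤ (1 - (n : ℝ)⁻¹) * D := by gcongr

end Barycenter

/-! ### Barycentric subdivision as an antipodally equivariant chain map. -/

section Subdivision

variable {E : Type*} [AddCommGroup E] [Module ℝ E]

open Classical in
/-- The barycentric subdivision of a simplex. -/
noncomputable def subdivideSimplex (s : Multiset E) : ModTwoChain E :=
  if s = 0 then single 0 1
  else cone (barycenter s) (s.attach.map fun v => subdivideSimplex (s.erase v.1)).sum
termination_by s.card
decreasing_by exact Multiset.card_erase_lt_of_mem v.2

/-- Barycentric subdivision of chains. -/
noncomputable def subdivide : ModTwoChain E →ₗ[ZMod 2] ModTwoChain E :=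
  extend subdivideSimplex

@[simp] lemma subdivide_single_zero :
    subdivide (single (0 : Multiset E) 1) = single 0 1 := by
  rw [subdivide, extend_single, subdivideSimplex, if_pos rfl]

lemma subdivide_single {s : Multiset E} (hs : s ≠ 0) :
    subdivide (single s 1) = cone (barycenter s) (subdivide (boundary (single s 1))) := by
  classical
  rw [boundary_single, map_multiset_sum, Multiset.map_map, subdivide, extend_single,
    subdivideSimplex, if_neg hs]
  simp only [Function.comp_apply, extend_single]
  rw [Multiset.attach_map_val' s fun v => subdivideSimplex (s.erase v)]

lemma subdivide_vertex (v : E) : subdivide (single {v} 1) = single {v} 1 := by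
  have h : boundary (single ({v} : Multiset E) 1) = single 0 1 := by
    simpa using boundary_single_cons v 0
  rw [subdivide_single (by simp), h]
  simp [barycenter]

lemma boundary_subdivide (c : ModTwoChain E) :
    boundary (subdivide c) = subdivide (boundary c) := by
  have : (boundary : ModTwoChain E →ₗ[ZMod 2] _) ∘ₗ subdivide = subdivide ∘ₗ boundary := by
    refine hom_ext fun s => ?_
    induction s using face_induction with
    | zero => simp
    | step s h ih =>
      have := eqOn_of_carried _ _ ih (boundary_single_mem_carried s)
      simp only [LinearMap.comp_apply] at this ⊢
      rw [subdivide_single h, boundary_cone, this, boundary_boundary, map_zero, map_zero, add_zero]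
  exact LinearMap.congr_fun this c

lemma subdivide_map_neg (c : ModTwoChain E) :
    subdivide (map Neg.neg c) = map Neg.neg (subdivide c) := by
  have : (subdivide : ModTwoChain E →ₗ[ZMod 2] _) ∘ₗ map Neg.neg =
      map Neg.neg ∘ₗ subdivide := by
    refine hom_ext fun s => ?_
    induction s using face_induction with
    | zero => simp
    | step s h ih =>
      have := eqOn_of_carried _ _ ih (boundary_single_mem_carried s)
      simp only [LinearMap.comp_apply] at this ⊢
      rw [map_single, subdivide_single (by simpa using h), ← map_single, boundary_map, this,
        subdivide_single h, map_cone, barycenter_map_neg]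
  exact LinearMap.congr_fun this c

end Subdivision

/-! ### Shrinking of the mesh under subdivision. -/

section Mesh

variable {E : Type*} [NormedAddCommGroup E] [NormedSpace ℝ E]

/-- A simplex with `n` vertices, all in a member of `𝒦`, and of diameter at most `D`. -/
def IsFine (𝒦 : Set (Set E)) (n : ℕ) (D : ℝ) (s : Multiset E) : Prop :=
  s.card = n ∧ (∃ K ∈ 𝒦, ∀ v ∈ s, v ∈ K) ∧ ∀ u ∈ s, ∀ v ∈ s, dist u v ≤ D

lemma subdivide_single_mem_carried {n : ℕ} {D : ℝ} (s : Multiset E) (hn : s.card ≤ n)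
    (hD : ∀ u ∈ s, ∀ v ∈ s, dist u v ≤ D) {K : Set E} (hK : Convex ℝ K) (hs : ∀ v ∈ s, v ∈ K) :
    subdivide (single s 1) ∈ carried fun t => t.card = s.card ∧ (∀ v ∈ t, v ∈ K) ∧
      ∀ u ∈ t, ∀ v ∈ t, dist u v ≤ (1 - (n : ℝ)⁻¹) * D := by
  classical
  induction s using face_induction generalizing K with
  | zero =>
    rw [subdivide_single_zero]
    exact single_mem_carried (by simp)
  | step s h ih =>
    set b := barycenter s with hb
    set D' := (1 - (n : ℝ)⁻¹) * D with hD'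
    have hbK : b ∈ K := barycenter_mem hK h hs
    have hball : ∀ v ∈ s, dist v b ≤ D' := fun v hv => dist_barycenter_le hn hD hv
    have hD0 : 0 ≤ D' := by
      obtain ⟨v, hv⟩ := Multiset.exists_mem_of_ne_zero h
      exact dist_nonneg.trans (hball v hv)
    rw [subdivide_single h, boundary_single, map_multiset_sum, map_multiset_sum]
    refine multiset_sum_mem _ fun c hc => ?_
    simp only [Multiset.map_map, Multiset.mem_map, Function.comp_apply] at hc
    obtain ⟨v, hv, rfl⟩ := hc
    have hsub : ∀ u ∈ s.erase v, u ∈ s := fun u hu => Multiset.mem_of_mem_erase hu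
    refine cone_mem_carried ?_ (ih (s.erase v) (Multiset.erase_lt.2 hv)
      ((Multiset.card_le_card (Multiset.erase_le _ _)).trans hn)
      (fun u hu w hw => hD u (hsub u hu) w (hsub w hw))
      -- Intersecting `K` with a ball about the barycenter makes the induction hypothesis also keep
      -- the new vertices of the face within `D'` of the apex.
      (hK.inter (convex_closedBall b D'))
      (fun u hu => ⟨hs u (hsub u hu), hball u (hsub u hu)⟩))
    rintro t ⟨hcard, htK, htD⟩
    refine ⟨?_, ?_, ?_⟩
    · rw [Multiset.card_cons, hcard, Multiset.card_erase_add_one hv]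
    · exact Multiset.forall_mem_cons.2 ⟨hbK, fun u hu => (htK u hu).1⟩
    · intro u hu w hw
      rcases Multiset.mem_cons.1 hu with rfl | hu <;> rcases Multiset.mem_cons.1 hw with rfl | hw
      · simpa using hD0
      · rw [dist_comm]
        exact (htK w hw).2
      · exact (htK u hu).2
      · exact htD u hu w hw

lemma subdivide_mem_carried {𝒦 : Set (Set E)} (h𝒦 : ∀ K ∈ 𝒦, Convex ℝ K) {n N : ℕ} (hn : n ≤ N)
    {D : ℝ} {c : ModTwoChain E} (hc : c ∈ carried (IsFine 𝒦 n D)) :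
    subdivide c ∈ carried (IsFine 𝒦 n ((1 - (N : ℝ)⁻¹) * D)) := by
  refine map_mem_of_carried _ _ ?_ hc
  rintro s ⟨hs, ⟨K, hK, hsK⟩, hD⟩
  refine carried_mono ?_ (subdivide_single_mem_carried (n := N) s (hs.trans_le hn) hD (h𝒦 K hK) hsK)
  rintro t ⟨h1, h2, h3⟩
  exact ⟨h1.trans hs, ⟨K, hK, h2⟩, h3⟩

lemma iterate_subdivide_mem_carried {𝒦 : Set (Set E)} (h𝒦 : ∀ K ∈ 𝒦, Convex ℝ K) {n N : ℕ}
    (hn : n ≤ N) {D : ℝ} {c : ModTwoChain E} (hc : c ∈ carried (IsFine 𝒦 n D)) (r : ℕ) :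
    subdivide^[r] c ∈ carried (IsFine 𝒦 n ((1 - (N : ℝ)⁻¹) ^ r * D)) := by
  induction r with
  | zero => simpa using hc
  | succ r ih =>
    rw [Function.iterate_succ_apply', pow_succ', mul_assoc]
    exact subdivide_mem_carried h𝒦 hn ih

end Mesh

end ModTwoChain

namespace ModTwoChain

open Finsupp

/-! ### Parity of alternating simplices of signed labels. -/

section Alternating

variable {ι : Type*}

/-- The indicator of the lists of signed labels whose signs alternate, starting with `b`. -/
def alternating : Bool → List (ι ×ₗ Bool) → ZMod 2
  | _, [] => 1
  | b, a :: l => if (ofLex a).2 = b then alternating (!b) l else 0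

/-- The antipodal signed label. -/
def flip (a : ι ×ₗ Bool) : ι ×ₗ Bool := toLex ((ofLex a).1, !(ofLex a).2)

/-- A simplex of labels without two antipodal vertices. -/
def NoComplementary (s : Multiset (ι ×ₗ Bool)) : Prop :=
  ∀ u ∈ s, ∀ v ∈ s, (ofLex u).1 = (ofLex v).1 → (ofLex u).2 = (ofLex v).2

lemma alternating_map_flip (b : Bool) (l : List (ι ×ₗ Bool)) :
    alternating b (l.map flip) = alternating (!b) l := by
  induction l generalizing b with
  | nil => rfl
  | cons a l ih =>
    simp only [List.map_cons, alternating, ih, flip, ofLex_toLex]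
    congr 1
    cases (ofLex a).2 <;> cases b <;> simp

variable [LinearOrder ι]

/-- The number modulo two of simplices whose signs, ordered by label, alternate starting
with `b`. -/
noncomputable def alternatingCount (b : Bool) : ModTwoChain (ι ×ₗ Bool) →ₗ[ZMod 2] ZMod 2 :=
  extend fun s => alternating b (s.sort (· ≤ ·))

lemma alternatingCount_single (b : Bool) (s : Multiset (ι ×ₗ Bool)) :
    alternatingCount b (single s 1) = alternating b (s.sort (· ≤ ·)) := extend_single _ _

lemma alternatingCount_single_coe (b : Bool) {l : List (ι ×ₗ Bool)} (hl : l.Pairwise (· ≤ ·)) :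
    alternatingCount b (single (l : Multiset (ι ×ₗ Bool)) 1) = alternating b l := by
  rw [alternatingCount_single, Multiset.coe_sort, List.mergeSort_eq_self]
  simpa using hl

lemma alternatingCount_cone (b : Bool) (a : ι ×ₗ Bool) {c : ModTwoChain (ι ×ₗ Bool)}
    (hc : c ∈ carried fun s => ∀ v ∈ s, a ≤ v) :
    alternatingCount b (cone a c) = if (ofLex a).2 = b then alternatingCount (!b) c else 0 := by
  have := eqOn_of_carried (alternatingCount b ∘ₗ cone a)
    (if (ofLex a).2 = b then alternatingCount (!b) else 0) (fun s hs => ?_) hc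
  · rw [LinearMap.comp_apply] at this
    rw [this]
    split_ifs <;> rfl
  · rw [LinearMap.comp_apply, cone_single, alternatingCount_single, Multiset.sort_cons a s _ hs,
      alternating]
    split_ifs
    · rw [alternatingCount_single]
    · rfl

/-- Removing the head `a` leaves `l`; removing any other vertex keeps `a` in front. If `a` has sign
`b`, induction on `l` makes the terms `alternating b l` cancel modulo two; otherwise only the
removal of `a` contributes. -/
lemma alternatingCount_boundary_coe (b : Bool) {l : List (ι ×ₗ Bool)}
    (hl : l.Pairwise (· ≤ ·)) :
    alternatingCount b (boundary (single (l : Multiset (ι ×ₗ Bool)) 1)) =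
      alternating b l + alternating (!b) l := by
  induction l generalizing b with
  | nil => simp [alternating, CharTwo.add_self_eq_zero]
  | cons a l ih =>
    rw [List.pairwise_cons] at hl
    have hc : boundary (single (l : Multiset (ι ×ₗ Bool)) 1) ∈
        carried fun s => ∀ v ∈ s, a ≤ v :=
      carried_mono (fun t ht v hv => hl.1 v (Multiset.mem_of_le ht.le hv))
        (boundary_single_mem_carried _)
    rw [← Multiset.cons_coe, boundary_single_cons, map_add, alternatingCount_cone b a hc,
      alternatingCount_single_coe _ hl.2, ih _ hl.2, alternating, alternating, Bool.not_not]
    by_cases h : (ofLex a).2 = b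
    · have h' : (ofLex a).2 ≠ !b := by rw [h]; cases b <;> simp
      rw [if_pos h, if_pos h, if_neg h', add_zero, add_comm (alternating (!b) l), ← add_assoc,
        CharTwo.add_self_eq_zero, zero_add]
    · have h' : (ofLex a).2 = !b := by cases b <;> simpa using h
      rw [if_neg h, if_neg h, if_pos h', add_zero, zero_add]

lemma alternatingCount_boundary (b : Bool) (c : ModTwoChain (ι ×ₗ Bool)) :
    alternatingCount b (boundary c) = alternatingCount b c + alternatingCount (!b) c := by
  have : alternatingCount b ∘ₗ boundary =
      alternatingCount b + alternatingCount (ι := ι) (!b) := by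
    refine hom_ext fun s => ?_
    have := alternatingCount_boundary_coe b (s.pairwise_sort (· ≤ ·))
    rw [Multiset.sort_eq] at this
    simpa [alternatingCount_single] using this
  exact LinearMap.congr_fun this c

/-- Without antipodal labels, equal indices have equal signs, so `flip` preserves the lexicographic
order on the simplex and the sorted list just changes all its signs. -/
lemma alternatingCount_map_flip (b : Bool) {c : ModTwoChain (ι ×ₗ Bool)}
    (hc : c ∈ carried NoComplementary) :
    alternatingCount b (map flip c) = alternatingCount (!b) c := by
  refine eqOn_of_carried (alternatingCount b ∘ₗ map flip) _ (fun s hs => ?_) hc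
  rw [LinearMap.comp_apply, map_single, alternatingCount_single, alternatingCount_single,
    ← alternating_map_flip, Multiset.map_sort flip s (r := (· ≤ ·)) (r' := (· ≤ ·))]
  intro u hu v hv
  have := hs u hu v hv
  simp only [flip, Prod.Lex.le_iff, ofLex_toLex]
  constructor <;> rintro (h | ⟨h, h'⟩)
  · exact Or.inl h
  · exact Or.inr ⟨h, by rw [this h]⟩
  · exact Or.inl h
  · exact Or.inr ⟨h, by rw [this h]⟩

/-- Consecutive signs differ, so consecutive indices cannot agree: they increase strictly, and there
are too few of them. -/
lemma alternating_eq_zero [Fintype ι] {l : List (ι ×ₗ Bool)} (hl : l.Pairwise (· ≤ ·))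
    (hc : NoComplementary (l : Multiset (ι ×ₗ Bool))) (hcard : Fintype.card ι < l.length)
    (b : Bool) : alternating b l = 0 := by
  by_contra hne
  have key : ∀ (b : Bool) (l : List (ι ×ₗ Bool)), l.Pairwise (· ≤ ·) →
      NoComplementary (l : Multiset (ι ×ₗ Bool)) → alternating b l ≠ 0 →
      (l.map fun a => (ofLex a).1).IsChain (· < ·) := by
    intro b l
    induction l generalizing b with
    | nil => simp
    | cons a l ih =>
      intro hl hc hne
      have ha : (ofLex a).2 = b := by
        by_contra h
        simp [alternating, h] at hne
      rw [alternating, if_pos ha] at hne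
      have hl' := List.pairwise_cons.1 hl
      have h := ih (!b) hl'.2
        (fun u hu v hv => hc u (List.mem_cons_of_mem a hu) v (List.mem_cons_of_mem a hv)) hne
      cases l with
      | nil => simp
      | cons a' l =>
        have ha' : (ofLex a').2 = !b := by
          by_contra h
          simp [alternating, h] at hne
        refine List.isChain_cons_cons.2 ⟨?_, h⟩
        rcases Prod.Lex.le_iff.1 (hl'.1 a' (by simp)) with h1 | ⟨h1, -⟩
        · exact h1
        · have := hc a (by simp) a' (by simp) h1
          rw [ha, ha'] at this
          cases b <;> simp at this
  have hnd := (List.isChain_iff_pairwise.1 (key b l hl hc hne)).imp fun h => ne_of_lt h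
  have := List.Nodup.length_le_card hnd
  rw [List.length_map] at this
  omega

lemma alternatingCount_eq_zero [Fintype ι] {n : ℕ} (hn : Fintype.card ι < n) (b : Bool)
    {c : ModTwoChain (ι ×ₗ Bool)} (hc : c ∈ carried fun s => s.card = n ∧ NoComplementary s) :
    alternatingCount b c = 0 := by
  refine eqOn_of_carried _ 0 (fun s hs => ?_) hc
  rw [alternatingCount_single]
  refine alternating_eq_zero (s.pairwise_sort _) ?_ (by rw [Multiset.length_sort, hs.1]; exact hn) b
  rw [Multiset.sort_eq]
  exact hs.2

/-- A combinatorial form of the Borsuk–Ulam theorem: there is no equivariant chain of hemispheres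
up to dimension `n` with labels in a set of `n` elements. -/
theorem no_hemispheres [Fintype ι] {n : ℕ} (hn : Fintype.card ι = n)
    (h : ℕ → ModTwoChain (ι ×ₗ Bool))
    (hcar : ∀ k ≤ n, h k ∈ carried fun s => s.card = k + 1 ∧ NoComplementary s)
    (h0 : ∃ a, h 0 = single {a} 1)
    (hb : ∀ k < n, boundary (h (k + 1)) = h k + map flip (h k)) : False := by
  -- The parity passes from `h k` to `h (k + 1)` by evaluating `alternatingCount` on the boundary in
  -- two ways: by the general formula, and through `hb` with the flip exchanging the two starting
  -- signs.
  have key : ∀ k ≤ n, alternatingCount true (h k) + alternatingCount false (h k) = 1 := by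
    intro k
    induction k with
    | zero =>
      intro _
      obtain ⟨a, ha⟩ := h0
      rw [ha, alternatingCount_single, alternatingCount_single, Multiset.sort_singleton]
      cases h : (ofLex a).2 <;> simp [alternating, h]
    | succ k ih =>
      intro hk
      rw [← ih (by omega), ← Bool.not_true, ← alternatingCount_boundary, hb k (by omega), map_add,
        alternatingCount_map_flip _ (carried_mono (fun s hs => hs.2) (hcar k (by omega)))]
  have := key n le_rfl
  rw [alternatingCount_eq_zero (by omega) _ (hcar n le_rfl),
    alternatingCount_eq_zero (by omega) _ (hcar n le_rfl)] at this
  simp at this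

end Alternating

end ModTwoChain

namespace ModTwoChain

open Finsupp

/-! ### Hemispheres of the crosspolytope. -/

section Crosspolytope

/-- The facet of the crosspolytope in the orthant with signs `ε`. -/
def facet {d : ℕ} (ε : Fin d → ℝ) : Set (Fin d → ℝ) :=
  {x | (∀ i, 0 ≤ ε i * x i) ∧ ∑ i, ε i * x i = 1}

/-- The facets of the crosspolytope. -/
def facets (d : ℕ) : Set (Set (Fin d → ℝ)) :=
  {K | ∃ ε : Fin d → ℝ, (∀ i, |ε i| = 1) ∧ K = facet ε}

lemma convex_facet {d : ℕ} (ε : Fin d → ℝ) : Convex ℝ (facet ε) := by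
  rintro x ⟨hx, hx'⟩ y ⟨hy, hy'⟩ a b ha hb hab
  have e : ∀ i, ε i * (a • x + b • y) i = a * (ε i * x i) + b * (ε i * y i) := fun i => by
    simp only [Pi.add_apply, Pi.smul_apply, smul_eq_mul]
    ring
  constructor
  · intro i
    rw [e]
    exact add_nonneg (mul_nonneg ha (hx i)) (mul_nonneg hb (hy i))
  · simp_rw [e, Finset.sum_add_distrib, ← Finset.mul_sum, hx', hy', mul_one, hab]

lemma sum_abs_of_mem_facet {d : ℕ} {ε : Fin d → ℝ} (hε : ∀ i, |ε i| = 1) {x : Fin d → ℝ}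
    (hx : x ∈ facet ε) : ∑ i, |x i| = 1 := by
  rw [← hx.2]
  refine Finset.sum_congr rfl fun i _ => ?_
  rw [← abs_of_nonneg (hx.1 i), abs_mul, hε, one_mul]

lemma norm_le_of_sum_abs {d : ℕ} {x : Fin d → ℝ} (hx : ∑ i, |x i| = 1) : ‖x‖ ≤ 1 := by
  rw [pi_norm_le_iff_of_nonneg zero_le_one]
  intro i
  rw [Real.norm_eq_abs, ← hx]
  exact Finset.single_le_sum (f := fun i => |x i|) (fun j _ => abs_nonneg _) (Finset.mem_univ i)

/-- The `k`-th coordinate vector. -/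
def coordVec (d k : ℕ) : Fin d → ℝ := fun i => if (i : ℕ) = k then 1 else 0

/-- The hemispheres of the crosspolytope of dimension `d`. -/
noncomputable def hemisphere (d : ℕ) : ℕ → ModTwoChain (Fin d → ℝ)
  | 0 => single {coordVec d 0} 1
  | k + 1 => cone (coordVec d (k + 1)) (hemisphere d k + map Neg.neg (hemisphere d k))

lemma map_neg_map_neg {E : Type*} [AddCommGroup E] (c : ModTwoChain E) :
    map Neg.neg (map Neg.neg c) = c := by
  have : (map Neg.neg ∘ₗ map Neg.neg : ModTwoChain E →ₗ[ZMod 2] _) = LinearMap.id :=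
    hom_ext fun s => by simp
  exact LinearMap.congr_fun this c

/-- The cone bounds exactly its base because the base is a cycle: the boundary of a hemisphere is
antipodally invariant, so the two hemispheres contribute it twice. -/
lemma boundary_hemisphere (d k : ℕ) :
    boundary (hemisphere d (k + 1)) = hemisphere d k + map Neg.neg (hemisphere d k) := by
  suffices h : boundary (hemisphere d k + map Neg.neg (hemisphere d k)) = 0 by
    rw [hemisphere, boundary_cone, h, map_zero, add_zero]
  induction k with
  | zero =>
    have h (v : Fin d → ℝ) : boundary (single ({v} : Multiset (Fin d → ℝ)) 1) = single 0 1 := by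
      simpa using boundary_single_cons v 0
    rw [hemisphere, map_single, Multiset.map_singleton, map_add, h, h, ZModModule.add_self]
  | succ k ih =>
    have h : boundary (hemisphere d (k + 1)) =
        hemisphere d k + map Neg.neg (hemisphere d k) := by
      rw [hemisphere, boundary_cone, ih, map_zero, add_zero]
    rw [map_add, boundary_map, h, map_add, map_neg_map_neg,
      add_comm (map Neg.neg (hemisphere d k)), ZModModule.add_self]

/-- The vanishing of the later coordinates allows the sign at `k + 1` to be reset to `1` when the
new apex is added. -/
lemma hemisphere_mem_carried_aux {d k : ℕ} (hk : k < d) :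
    hemisphere d k ∈ carried fun s => s.card = k + 1 ∧
      ∃ ε : Fin d → ℝ, (∀ i, |ε i| = 1) ∧ ∀ x ∈ s, x ∈ facet ε ∧ ∀ i : Fin d, k < i → x i = 0 := by
  induction k with
  | zero =>
    refine single_mem_carried ⟨by simp, 1, by simp, ?_⟩
    intro x hx
    rw [Multiset.mem_singleton] at hx
    subst hx
    refine ⟨⟨fun i => ?_, ?_⟩, fun i hi => if_neg hi.ne'⟩
    · simp only [coordVec]
      split_ifs <;> simp
    · rw [Finset.sum_eq_single ⟨0, hk⟩] <;> simp [coordVec, Fin.ext_iff]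
  | succ k ih =>
    have ih := ih (by omega)
    rw [hemisphere]
    refine cone_mem_carried ?_ (Submodule.add_mem _ ih (map_mem_carried ?_ ih))
    · rintro s ⟨hs, ε, hε, hsε⟩
      refine ⟨by simp [hs], Function.update ε ⟨k + 1, hk⟩ 1, fun i => ?_, ?_⟩
      · rcases eq_or_ne i ⟨k + 1, hk⟩ with rfl | hi
        · simp
        · simp [hi, hε]
      · refine Multiset.forall_mem_cons.2 ⟨⟨⟨fun i => ?_, ?_⟩, fun i hi => if_neg hi.ne'⟩,
          fun x hx => ?_⟩
        · rcases eq_or_ne i ⟨k + 1, hk⟩ with rfl | hi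
          · simp [coordVec]
          · have : (i : ℕ) ≠ k + 1 := fun h => hi (Fin.ext h)
            simp [coordVec, this]
        · rw [Finset.sum_eq_single ⟨k + 1, hk⟩]
          · simp [coordVec]
          · intro i _ hi
            have : (i : ℕ) ≠ k + 1 := fun h => hi (Fin.ext h)
            simp [coordVec, this]
          · simp
        · obtain ⟨⟨h1, h2⟩, h3⟩ := hsε x hx
          have e : ∀ i, Function.update ε ⟨k + 1, hk⟩ 1 i * x i = ε i * x i := fun i => by
            rcases eq_or_ne i ⟨k + 1, hk⟩ with rfl | hi
            · simp [h3 ⟨k + 1, hk⟩ (Nat.lt_succ_self k)]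
            · simp [hi]
          refine ⟨⟨fun i => by rw [e]; exact h1 i, by simp_rw [e]; exact h2⟩,
            fun i hi => h3 i (by omega)⟩
    · rintro s ⟨hs, ε, hε, hsε⟩
      refine ⟨by simpa using hs, -ε, by simpa using hε, ?_⟩
      intro x hx
      obtain ⟨y, hy, rfl⟩ := Multiset.mem_map.1 hx
      obtain ⟨⟨h1, h2⟩, h3⟩ := hsε y hy
      exact ⟨⟨by simpa using h1, by simpa using h2⟩, fun i hi => by simp [h3 i hi]⟩

lemma hemisphere_mem_carried {d k : ℕ} (hk : k < d) :
    hemisphere d k ∈ carried (IsFine (facets d) (k + 1) 2) := by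
  refine carried_mono ?_ (hemisphere_mem_carried_aux hk)
  rintro s ⟨hs, ε, hε, h⟩
  refine ⟨hs, ⟨_, ⟨ε, hε, rfl⟩, fun v hv => (h v hv).1⟩, fun u hu v hv => ?_⟩
  have hu := norm_le_of_sum_abs (sum_abs_of_mem_facet hε (h u hu).1)
  have hv := norm_le_of_sum_abs (sum_abs_of_mem_facet hε (h v hv).1)
  linarith [dist_le_norm_add_norm u v]

end Crosspolytope

/-! ### The Borsuk–Ulam theorem. -/

section BorsukUlam

lemma isCompact_sum_abs_eq_one (d : ℕ) : IsCompact {x : Fin d → ℝ | ∑ i, |x i| = 1} := by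
  refine (isCompact_closedBall (0 : Fin d → ℝ) 1).of_isClosed_subset
    (isClosed_eq (by fun_prop) continuous_const) fun x hx => ?_
  simpa using norm_le_of_sum_abs hx

/-- There is no antipodal labelling of the crosspolytope of dimension `n + 1` by `n` signed
labels for which nearby points never carry opposite labels. -/
theorem no_antipodal_labelling {n : ℕ} (label : (Fin (n + 1) → ℝ) → Fin n ×ₗ Bool)
    (hneg : ∀ x, ∑ i, |x i| = 1 → label (-x) = flip (label x)) {δ : ℝ} (hδ : 0 < δ)
    (hnear : ∀ x y, ∑ i, |x i| = 1 → ∑ i, |y i| = 1 → dist x y < δ →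
      (ofLex (label x)).1 = (ofLex (label y)).1 → (ofLex (label x)).2 = (ofLex (label y)).2) :
    False := by
  -- The hemispheres start with diameter bound `2`, hence `δ / 2`.
  obtain ⟨r, hr⟩ : ∃ r : ℕ, (1 - ((n + 1 : ℕ) : ℝ)⁻¹) ^ r < δ / 2 := by
    refine exists_pow_lt_of_lt_one (by positivity) ?_
    have : (0 : ℝ) < ((n + 1 : ℕ) : ℝ)⁻¹ := by positivity
    linarith
  set S : Module.End (ZMod 2) (ModTwoChain (Fin (n + 1) → ℝ)) := subdivide ^ r with hS
  have hSb (c : ModTwoChain (Fin (n + 1) → ℝ)) : boundary (S c) = S (boundary c) := by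
    rw [hS, Module.End.pow_apply, Module.End.pow_apply]
    exact (Function.Semiconj.iterate_right (f := boundary) boundary_subdivide r) c
  have hSn (c : ModTwoChain (Fin (n + 1) → ℝ)) : S (map Neg.neg c) = map Neg.neg (S c) := by
    rw [hS, Module.End.pow_apply, Module.End.pow_apply]
    exact ((Function.Semiconj.iterate_right (f := map Neg.neg)
      (fun c => (subdivide_map_neg c).symm) r) c).symm
  have hcar : ∀ k ≤ n, S (hemisphere (n + 1) k) ∈ carried fun s : Multiset (Fin (n + 1) → ℝ) =>
      s.card = k + 1 ∧ (∀ x ∈ s, ∑ i, |x i| = 1) ∧ ∀ x ∈ s, ∀ y ∈ s, dist x y < δ := by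
    intro k hk
    rw [hS, Module.End.pow_apply]
    refine carried_mono ?_ (iterate_subdivide_mem_carried (N := n + 1) ?_ (by omega)
      (hemisphere_mem_carried (by omega)) r)
    · rintro s ⟨h1, ⟨K, ⟨ε, hε, rfl⟩, h2⟩, h3⟩
      exact ⟨h1, fun x hx => sum_abs_of_mem_facet hε (h2 x hx),
        fun x hx y hy => (h3 x hx y hy).trans_lt (by linarith)⟩
    · rintro K ⟨ε, -, rfl⟩
      exact convex_facet ε
  refine no_hemispheres (Fintype.card_fin n) (fun k => map label (S (hemisphere (n + 1) k)))
    ?_ ?_ ?_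
  · intro k hk
    refine map_mem_carried ?_ (hcar k hk)
    rintro s ⟨h1, h2, h3⟩
    refine ⟨by simpa using h1, fun u hu v hv => ?_⟩
    obtain ⟨x, hx, rfl⟩ := Multiset.mem_map.1 hu
    obtain ⟨y, hy, rfl⟩ := Multiset.mem_map.1 hv
    exact hnear x y (h2 x hx) (h2 y hy) (h3 x hx y hy)
  · refine ⟨label (coordVec (n + 1) 0), ?_⟩
    rw [hS, Module.End.pow_apply, hemisphere, Function.iterate_fixed (subdivide_vertex _)]
    simp
  · intro k hk
    rw [boundary_map, hSb, boundary_hemisphere, map_add, map_add, hSn]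
    congr 1
    refine eqOn_of_carried (map label ∘ₗ map Neg.neg) (map flip ∘ₗ map label) ?_
      (hcar k (by omega))
    rintro s ⟨-, h2, -⟩
    simp only [LinearMap.comp_apply, map_single, Multiset.map_map]
    congr 1
    exact Multiset.map_congr rfl fun x hx => hneg x (h2 x hx)

end BorsukUlam

end ModTwoChain

/-- The **Borsuk–Ulam theorem**: an odd continuous map from `ℝⁿ⁺¹` to `ℝⁿ` has a zero on the
unit sphere of the `ℓ¹` norm. -/
theorem exists_sum_abs_eq_one_and_eq_zero_of_odd {n : ℕ} {F : (Fin (n + 1) → ℝ) → (Fin n → ℝ)}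
    (hF : Continuous F) (hodd : ∀ x, F (-x) = -F x) : ∃ x, ∑ i, |x i| = 1 ∧ F x = 0 := by
  by_contra! h
  have hX := ModTwoChain.isCompact_sum_abs_eq_one (n + 1)
  set X := {x : Fin (n + 1) → ℝ | ∑ i, |x i| = 1}
  have hne : X.Nonempty := ⟨Pi.single 0 1, by
    change ∑ i, |(Pi.single 0 1 : Fin (n + 1) → ℝ) i| = 1
    rw [Finset.sum_eq_single 0] <;> simp +contextual⟩
  obtain ⟨x₀, hx₀, hmin⟩ := hX.exists_isMinOn hne hF.norm.continuousOn
  set c := ‖F x₀‖ with hc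
  have hc0 : 0 < c := norm_pos_iff.2 (h x₀ hx₀)
  have hbig : ∀ x ∈ X, ∃ i, c ≤ |F x i| := by
    intro x hx
    by_contra! hlt
    exact absurd ((pi_norm_lt_iff hc0).2 hlt) (not_lt.2 (hmin hx))
  obtain ⟨i₀, -⟩ := hbig x₀ hx₀
  -- The index is chosen as a function of `|F x|` alone, so that `x` and `-x` get the same one; `i₀`
  -- is a default value.
  have hex : ∀ u : Fin n → ℝ, ∃ i, (∃ j, c ≤ u j) → c ≤ u i := by
    intro u
    by_cases hu : ∃ j, c ≤ u j
    · exact hu.imp fun j hj _ => hj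
    · exact ⟨i₀, fun hu' => absurd hu' hu⟩
  choose g hg using hex
  have hg' : ∀ x ∈ X, c ≤ |F x (g |F x|)| := fun x hx => hg |F x| (hbig x hx)
  -- Values of opposite sign and modulus at least `c` differ by at least `2 * c`, so closeness
  -- within `c` fixes the sign.
  obtain ⟨δ, hδ, hunif⟩ := Metric.uniformContinuousOn_iff.1
    (hX.uniformContinuousOn_of_continuous hF.continuousOn) c hc0
  refine ModTwoChain.no_antipodal_labelling
    (fun x => toLex (g |F x|, decide (0 < F x (g |F x|)))) ?_ hδ ?_
  · intro x hx
    have h1 := hg' x hx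
    simp only [ModTwoChain.flip, ofLex_toLex, hodd, abs_neg, Pi.neg_apply]
    congr 2
    rw [← decide_not, decide_eq_decide, not_lt, neg_pos]
    refine ⟨le_of_lt, fun h' => lt_of_le_of_ne h' fun h0 => ?_⟩
    rw [h0, abs_zero] at h1
    linarith
  · intro x y hx hy hxy hidx
    simp only [ofLex_toLex] at hidx ⊢
    have h1 := hg' x hx
    have h2 := hg' y hy
    rw [← hidx] at h2 ⊢
    have h3 := (dist_le_pi_dist (F x) (F y) (g |F x|)).trans_lt (hunif x hx y hy hxy)
    rw [Real.dist_eq, abs_lt] at h3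
    rw [decide_eq_decide]
    rcases le_abs'.1 h1 with h1 | h1 <;> rcases le_abs'.1 h2 with h2 | h2 <;>
      constructor <;> intro <;> linarith

/-! ### From Borsuk–Ulam to bisecting affine functions. -/

section HamSandwich

open MeasureTheory Filter Topology

/-- The truncation of a real number to `[-1, 1]`. -/
noncomputable def truncate (t : ℝ) : ℝ := max (-1) (min 1 t)

lemma continuous_truncate : Continuous truncate := by
  unfold truncate
  fun_prop

lemma truncate_neg (t : ℝ) : truncate (-t) = -truncate t := by
  unfold truncate
  rcases le_total t 1 with h1 | h1 <;> rcases le_total (-1) t with h2 | h2 <;>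
    simp [min_def, max_def] <;> split_ifs <;> linarith

lemma truncate_le_one (t : ℝ) : truncate t ≤ 1 := max_le (by norm_num) (min_le_left _ _)

lemma abs_truncate_le_one (t : ℝ) : |truncate t| ≤ 1 :=
  abs_le.2 ⟨le_max_left _ _, truncate_le_one t⟩

lemma truncate_of_le {t : ℝ} (h : t ≤ -1) : truncate t = -1 :=
  max_eq_left ((min_le_right _ _).trans h)

lemma half_le_measure_of_integral_truncate_nonneg {Ω : Type*} [MeasurableSpace Ω] {μ : Measure Ω}
    [IsProbabilityMeasure μ] {w : ℕ → Ω → ℝ} {w₀ : Ω → ℝ} (hw : ∀ k, Measurable (w k))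
    (hw₀ : Measurable w₀) (hlim : ∀ v, Tendsto (fun k => w k v) atTop (𝓝 (w₀ v)))
    {t : ℕ → ℝ} (ht : Tendsto t atTop atTop)
    (hI : ∀ k, 0 ≤ ∫ v, truncate (t k * w k v) ∂μ) : 1 / 2 ≤ μ {v | 0 ≤ w₀ v} := by
  set A := {v | 0 ≤ w₀ v} with hA
  have hAm : MeasurableSet A := measurableSet_le measurable_const hw₀
  have hmeas (k : ℕ) : Measurable fun v => truncate (t k * w k v) :=
    continuous_truncate.measurable.comp ((hw k).const_mul _)
  -- On `A` the truncations need not converge, since `w₀` may vanish there, so they are replaced by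
  -- their upper bound `1`; off `A` they tend to `-1`. The limit integral is `μ A - μ Aᶜ`.
  have hdct : Tendsto (fun k => ∫ v, A.indicator (fun _ => 1) v +
      Aᶜ.indicator (fun v => truncate (t k * w k v)) v ∂μ) atTop
      (𝓝 (∫ v, A.indicator (fun _ => 1) v + Aᶜ.indicator (fun _ => -1) v ∂μ)) := by
    refine tendsto_integral_of_dominated_convergence (fun _ => (1 : ℝ)) (fun k => ?_)
      (integrable_const _) (fun k => ae_of_all _ fun v => ?_) (ae_of_all _ fun v => ?_)
    · exact ((measurable_const.indicator hAm).add
        ((hmeas k).indicator hAm.compl)).aestronglyMeasurable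
    · by_cases hv : v ∈ A <;> simp [hv, abs_truncate_le_one]
    · by_cases hv : v ∈ A
      · simp [hv]
      · have hv' : w₀ v < 0 := not_le.1 hv
        simp only [Set.indicator_of_notMem hv, Set.indicator_of_mem (Set.mem_compl hv)]
        refine tendsto_const_nhds.congr' ?_
        filter_upwards [(ht.atTop_mul_neg hv' (hlim v)).eventually_le_atBot (-1)] with k hk
        rw [truncate_of_le hk]
  have hnonneg := ge_of_tendsto' hdct fun k => (hI k).trans <| by
    have hb : ∀ v, ‖truncate (t k * w k v)‖ ≤ 1 := fun v => abs_truncate_le_one _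
    have hi : Integrable (fun v => truncate (t k * w k v)) μ :=
      Integrable.of_bound (hmeas k).aestronglyMeasurable 1 (ae_of_all _ hb)
    refine integral_mono hi (((integrable_const 1).indicator hAm).add (hi.indicator hAm.compl))
      fun v => ?_
    by_cases hv : v ∈ A <;> simp [hv, truncate_le_one]
  rw [integral_add ((integrable_const 1).indicator hAm)
    ((integrable_const (-1)).indicator hAm.compl), integral_indicator_const _ hAm,
    integral_indicator_const _ hAm.compl, probReal_compl_eq_one_sub hAm] at hnonneg
  simp only [smul_eq_mul] at hnonneg
  have hhalf : (1 / 2 : ℝ) ≤ μ.real A := by linarith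
  rw [Measure.real, ← ENNReal.ofReal_le_iff_le_toReal (measure_ne_top _ _)] at hhalf
  refine le_trans (le_of_eq ?_) hhalf
  rw [ENNReal.ofReal_div_of_pos two_pos]
  simp

/-- **Ham sandwich theorem** for finitely many measures, in terms of coordinates: the
functional is `v ↦ ∑ i, x i * a i v`, the level is the last coordinate of `x`. -/
theorem exists_bisecting_affine {Ω : Type*} [MeasurableSpace Ω] {n : ℕ} (a : Fin n → Ω → ℝ)
    (ha : ∀ i, Measurable (a i)) (μ : Fin n → Measure Ω) [∀ j, IsProbabilityMeasure (μ j)] :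
    ∃ (x : Fin n → ℝ) (y : ℝ), (x ≠ 0 ∨ y ≠ 0) ∧ ∀ j,
      1 / 2 ≤ μ j {v | ∑ i, x i * a i v ≤ y} ∧ 1 / 2 ≤ μ j {v | y ≤ ∑ i, x i * a i v} := by
  set w : (Fin (n + 1) → ℝ) → Ω → ℝ :=
    fun x v => x (Fin.last n) - ∑ i : Fin n, x i.castSucc * a i v with hw
  have hwm (x) : Measurable (w x) := by
    simp only [hw]
    fun_prop
  have hwc (v) : Continuous fun x => w x v := by
    simp only [hw]
    fun_prop
  have hwn (x v) : w (-x) v = -w x v := by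
    simp only [hw, Pi.neg_apply, neg_mul, Finset.sum_neg_distrib]
    ring
  have hzero (k : ℕ) : ∃ x : Fin (n + 1) → ℝ, ∑ i, |x i| = 1 ∧
      (fun j => ∫ v, truncate (k * w x v) ∂μ j) = 0 := by
    refine exists_sum_abs_eq_one_and_eq_zero_of_odd
      (F := fun x j => ∫ v, truncate (k * w x v) ∂μ j) ?_ ?_
    · refine continuous_pi fun j => continuous_of_dominated (bound := fun _ => (1 : ℝ))
        (fun x => ?_) (fun x => ae_of_all _ fun v => abs_truncate_le_one _)
        (integrable_const _) (ae_of_all _ fun v => ?_)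
      · exact (continuous_truncate.measurable.comp
          ((hwm x).const_mul _)).aestronglyMeasurable
      · exact continuous_truncate.comp (continuous_const.mul (hwc v))
    · intro x
      ext j
      simp only [hwn, mul_neg, truncate_neg, integral_neg, Pi.neg_apply]
  choose x hx hx0 using hzero
  obtain ⟨z, hz, φ, hφ, hlim⟩ := (ModTwoChain.isCompact_sum_abs_eq_one (n + 1)).tendsto_subseq hx
  have ht : Tendsto (fun k => (φ k : ℝ)) atTop atTop :=
    tendsto_natCast_atTop_atTop.comp hφ.tendsto_atTop
  have hwlim (v) : Tendsto (fun k => w (x (φ k)) v) atTop (𝓝 (w z v)) :=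
    ((hwc v).tendsto z).comp hlim
  refine ⟨fun i => z i.castSucc, z (Fin.last n), ?_, fun j => ⟨?_, ?_⟩⟩
  · by_contra! h
    have hz' : ∑ i, |z i| = 1 := hz
    rw [Fin.sum_univ_castSucc, h.2] at hz'
    simp [fun i => congrFun h.1 i] at hz'
  · have := half_le_measure_of_integral_truncate_nonneg (μ := μ j) (fun k => hwm (x (φ k)))
      (hwm z) hwlim ht fun k => (congrFun (hx0 (φ k)) j).ge
    simpa [hw] using this
  · have := half_le_measure_of_integral_truncate_nonneg (μ := μ j) (fun k => (hwm (x (φ k))).neg)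
      (hwm z).neg (fun v => (hwlim v).neg) ht fun k => by
        have := congrFun (hx0 (φ k)) j
        simp only [Pi.zero_apply] at this
        simp only [Pi.neg_apply, mul_neg, truncate_neg, integral_neg, this, neg_zero, le_refl]
    simpa [hw] using this

end HamSandwich

/-! ### Transfer from coordinates to `V`. -/

theorem theoremA1
    {V : Type*} [AddCommGroup V] [Module ℝ V] [TopologicalSpace V]
    [IsTopologicalAddGroup V] [ContinuousSMul ℝ V] [T2Space V]
    [MeasurableSpace V] [BorelSpace V]
    (l m : ℕ) (hV : Module.finrank ℝ V = m + 1) (hlm : l ≤ m)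
    (ν : Fin (l + 1) → MeasureTheory.Measure V)
    (hν : ∀ j, MeasureTheory.IsProbabilityMeasure (ν j)) :
    ∃ (f : Module.Dual ℝ V) (y : ℝ), f ≠ 0 ∧
      ∀ j, (1 / 2 : ENNReal) ≤ ν j {v : V | f v ≤ y} ∧
        (1 / 2 : ENNReal) ≤ ν j {v : V | y ≤ f v} := by
  have : FiniteDimensional ℝ V := Module.finite_of_finrank_pos (by omega)
  let b := Module.finBasisOfFinrankEq ℝ V hV
  obtain ⟨x, y, hxy, h⟩ := exists_bisecting_affine (fun i => b.coord i)
    (fun i => (b.coord i).continuous_of_finiteDimensional.measurable)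
    -- The family is padded to `m + 1` measures by repetition, with indices taken modulo `l + 1`.
    (fun j : Fin (m + 1) => ν (Fin.ofNat (l + 1) j))
  have hj (j : Fin (l + 1)) : Fin.ofNat (l + 1) (j.castLE (by omega) : Fin (m + 1)) = j := by
    ext
    simp
  set f : Module.Dual ℝ V := ∑ i, x i • b.coord i with hf
  have hfv (v : V) : f v = ∑ i, x i * b.coord i v := by
    simp [hf]
  have hbis (j : Fin (l + 1)) : (1 / 2 : ENNReal) ≤ ν j {v : V | f v ≤ y} ∧
      (1 / 2 : ENNReal) ≤ ν j {v : V | y ≤ f v} := by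
    have := h (j.castLE (by omega))
    rw [hj] at this
    simpa only [hfv] using this
  refine ⟨f, y, fun hf0 => ?_, hbis⟩
  have hx : x = 0 := by
    ext i
    have := hfv (b i)
    rw [hf0] at this
    simpa [Finsupp.single_apply] using this.symm
  -- If `f = 0`, then `y ≠ 0` and one of the two half-spaces is empty, which contradicts measure at
  -- least one half.
  have hy : y ≠ 0 := hxy.resolve_left fun hne => hne hx
  obtain ⟨h1, h2⟩ := hbis 0
  simp only [hf0, LinearMap.zero_apply] at h1 h2
  rcases lt_or_gt_of_ne hy with hy | hy
  · simp [not_le.2 hy] at h1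
  · simp [not_le.2 hy] at h2
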